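/- Words are over the alphabet $\{0,1\}$. An infinite word $w=a_0a_1a_2\cdots$ is \emph{purely periodic} if $w=vvv\cdots$ for some nonempty finite word $v$, and \emph{aperiodic} if it is not of the form $uvvv\cdots$ with finite words $u,v$, $v$ nonempty. A \emph{square} is a word $uu$ with $u$ a nonempty finite word; it is \emph{minimal} if none of its proper prefixes is a square. An infinite word is \emph{squareful} if a minimal square begins at each of its positions and only finitely many distinct minimal squares occur in it; it is \emph{optimal squareful} if it is aperiodic, squareful, and contains exactly $6$ distinct minimal squares. An infinite word $w$ is \emph{linearly recurrent} if each of its factors occurs in it infinitely often and there is a constant $K$ such that for every nonempty factor $u$ of $w$ the distance between any two consecutive occurrences of $u$ in $w$ is at most $K|u|$. An optimal squareful word $w$ has a unique factorization $w=X_1^2X_2^2X_3^2\cdots$ into minimal squares $X_i^2$, and its \emph{square root} is the infinite word $\sqrt{w}=X_1X_2X_3\cdots$. \textbf{Corollary.} There are uncountably many linearly recurrent optimal squareful words $w\in\{0,1\}^{\omega}$ whose square root $\sqrt{w}$ is purely periodic. -/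

import Mathlib

namespace InfWord

variable {α : Type*}

/-- The finite word `u` occurs in the infinite word `w` at position `i`. -/
def OccursAt (w : ℕ → α) (u : List α) (i : ℕ) : Prop :=
  List.ofFn (fun k : Fin u.length => w (i + k)) = u

/-- The finite word `u` is a factor of the infinite word `w`. -/
def IsFactor (w : ℕ → α) (u : List α) : Prop := ∃ i, OccursAt w u i

/-- `w = v v v ⋯` for some nonempty finite word `v` (of length `p`). -/
def PurelyPeriodic (w : ℕ → α) : Prop := ∃ p, 0 < p ∧ ∀ n, w (n + p) = w n

/-- `w = u v v v ⋯` for some finite words `u` and `v`, with `v` nonempty. -/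
def UltimatelyPeriodic (w : ℕ → α) : Prop :=
  ∃ N p, 0 < p ∧ ∀ n, N ≤ n → w (n + p) = w n

/-- An infinite word is aperiodic if it is not ultimately periodic. -/
def Aperiodic (w : ℕ → α) : Prop := ¬ UltimatelyPeriodic w

/-- A square is a word `u u` with `u` nonempty. -/
def IsSquareWord (s : List α) : Prop := ∃ u : List α, u ≠ [] ∧ s = u ++ u

/-- A square is minimal if no proper prefix of it is a square. -/
def IsMinimalSquare (s : List α) : Prop :=
  IsSquareWord s ∧ ∀ t : List α, t <+: s → t ≠ s → ¬ IsSquareWord t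

/-- The set of the minimal squares occurring in `w`. -/
def minimalSquares (w : ℕ → α) : Set (List α) := {s | IsMinimalSquare s ∧ IsFactor w s}

/-- Every position of `w` starts a minimal square, and only finitely many distinct minimal squares
occur in `w`. -/
def Squareful (w : ℕ → α) : Prop :=
  (∀ i, ∃ s, IsMinimalSquare s ∧ OccursAt w s i) ∧ (minimalSquares w).Finite

/-- An aperiodic squareful word containing exactly six minimal squares. -/
def OptimalSquareful (w : ℕ → α) : Prop :=
  Aperiodic w ∧ Squareful w ∧ (minimalSquares w).encard = 6

/-- Each factor of `w` occurs in it infinitely often. -/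
def Recurrent (w : ℕ → α) : Prop := ∀ u, IsFactor w u → {i | OccursAt w u i}.Infinite

/-- The supremum of the distances between two consecutive occurrences of `u` in `w`. -/
noncomputable def returnTime (w : ℕ → α) (u : List α) : ℕ∞ :=
  sSup {d | ∃ i j : ℕ, i < j ∧ OccursAt w u i ∧ OccursAt w u j ∧
    (∀ k, i < k → k < j → ¬ OccursAt w u k) ∧ d = ((j - i : ℕ) : ℕ∞)}

/-- `w` is recurrent, and the return time of each nonempty factor `u` is at most `K |u|`, for a
constant `K` that does not depend on `u`. -/
def LinearlyRecurrent (w : ℕ → α) : Prop :=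
  Recurrent w ∧ ∃ K : ℕ, ∀ u : List α, u ≠ [] → IsFactor w u →
    returnTime w u ≤ ((K * u.length : ℕ) : ℕ∞)

/-- `w = Y 0 · Y 1 · Y 2 ⋯` with all `Y n` nonempty: every finite partial product is a prefix
of `w`. -/
def IsInfiniteProduct (Y : ℕ → List α) (w : ℕ → α) : Prop :=
  (∀ n, Y n ≠ []) ∧ ∀ n, OccursAt w ((List.range n).map Y).flatten 0

/-- `v` is the square root of `w`: `w = X₀² X₁² X₂² ⋯` with all `Xₙ²` minimal squares, and
`v = X₀ X₁ X₂ ⋯`. No minimal square is a proper prefix of another one, so that `w` has at most one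
such factorization and at most one square root. -/
def IsSquareRoot (v w : ℕ → α) : Prop :=
  ∃ X : ℕ → List α, (∀ n, IsMinimalSquare (X n ++ X n)) ∧
    IsInfiniteProduct (fun n => X n ++ X n) w ∧ IsInfiniteProduct X v

end InfWord

namespace InfWord

/-! ### Words, minimal squares and square roots -/

section General

variable {α : Type*}

/-! The words 0101·00·1001010010 and 0101·00·1010·010010 (the two `block`s) are products of minimal
squares with the same square root `blockRoot`. Hence every infinite product of these blocks has the
periodic square root `rootWord`, whatever sequence `x` selects the blocks (`isSquareRoot_rootWord`).
A finite check shows that only six minimal squares arise, and all six do if both blocks are used.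
Aperiodicity and linear recurrence pass from `x` to the product. For `x`, take the paperfolding
sequences: they have both properties for every choice `f` of folding instructions, and `f` can be
recovered from the word, which gives uncountably many words. -/

theorem occursAt_iff {w : ℕ → α} {u : List α} {i : ℕ} :
    OccursAt w u i ↔ ∀ (k : ℕ) (h : k < u.length), w (i + k) = u[k] := by
  unfold OccursAt
  constructor
  · intro h k hk
    have := List.getElem_of_eq h (i := k) (by simpa using hk)
    simpa using this
  · intro h
    apply List.ext_getElem
    · simp
    · intro k h1 h2
      simpa using h k h2

theorem OccursAt.of_prefix_drop {w : ℕ → α} {u s : List α} {i r : ℕ} (h : OccursAt w u i)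
    (hs : s <+: u.drop r) : OccursAt w s (i + r) := by
  rw [occursAt_iff] at h ⊢
  intro k hk
  have hlen := hs.length_le
  rw [List.length_drop] at hlen
  rw [hs.getElem hk, List.getElem_drop, ← h (r + k) (by omega), Nat.add_assoc]

theorem OccursAt.append {w : ℕ → α} {u v : List α} {i : ℕ} (hu : OccursAt w u i)
    (hv : OccursAt w v (i + u.length)) : OccursAt w (u ++ v) i := by
  rw [occursAt_iff] at *
  intro k hk
  rw [List.getElem_append]
  split_ifs with h
  · exact hu k h
  · rw [← hv, Nat.add_assoc, Nat.add_sub_cancel' (by omega)]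

theorem OccursAt.prefix_of_length_le {w : ℕ → α} {u v : List α} {i : ℕ} (hu : OccursAt w u i)
    (hv : OccursAt w v i) (h : u.length ≤ v.length) : u <+: v := by
  rw [occursAt_iff] at *
  rw [List.prefix_iff_getElem]
  exact ⟨h, fun k hk => by rw [← hu k hk, ← hv k (by omega)]⟩

theorem IsMinimalSquare.eq_of_occursAt {w : ℕ → α} {s t : List α} {i : ℕ}
    (hs : IsMinimalSquare s) (ht : IsMinimalSquare t) (hsi : OccursAt w s i)
    (hti : OccursAt w t i) : s = t := by
  rcases le_total s.length t.length with h | h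
  · by_contra hne
    exact ht.2 s (hsi.prefix_of_length_le hti h) hne hs.1
  · by_contra hne
    exact hs.2 t (hti.prefix_of_length_le hsi h) (Ne.symm hne) ht.1

/-- The root of a shorter square prefix is a proper prefix of `u`, so minimality reduces to a
decidable check. -/
theorem isMinimalSquare_append_self {u : List α} (hu : u ≠ [])
    (h : ∀ k < u.length, 0 < k → u.take k ++ u.take k ≠ (u ++ u).take (2 * k)) :
    IsMinimalSquare (u ++ u) := by
  refine ⟨⟨u, hu, rfl⟩, ?_⟩
  rintro t ht hne ⟨v, hv, rfl⟩
  have hlen := ht.length_le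
  simp only [List.length_append] at hlen
  have hlt : v.length < u.length := by
    by_contra hge
    exact hne (ht.eq_of_length (by simp only [List.length_append]; omega))
  have hvu : v <+: u :=
    List.prefix_of_prefix_length_le ((List.prefix_append v v).trans ht)
      (List.prefix_append u u) hlt.le
  apply h v.length hlt (List.length_pos_iff.mpr hv)
  rw [← List.prefix_iff_eq_take.mp hvu, List.prefix_iff_eq_take.mp ht, List.length_append,
    Nat.two_mul]

/-- A word in which every block of length `n` reappears after at most `K * n` steps is linearly
recurrent. -/
theorem linearlyRecurrent_of_shift {w : ℕ → α} {K : ℕ}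
    (h : ∀ i n, 0 < n → ∃ d, 0 < d ∧ d ≤ K * n ∧ ∀ k < n, w (i + k + d) = w (i + k)) :
    LinearlyRecurrent w := by
  have next : ∀ u : List α, ∀ i n, 0 < n → u.length ≤ n → OccursAt w u i →
      ∃ d, 0 < d ∧ d ≤ K * n ∧ OccursAt w u (i + d) := by
    intro u i n hn hu hi
    obtain ⟨d, hd, hdK, hw⟩ := h i n hn
    refine ⟨d, hd, hdK, ?_⟩
    rw [occursAt_iff] at *
    intro k hk
    rw [Nat.add_right_comm, hw k (by omega), hi k hk]
  refine ⟨?_, K, ?_⟩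
  · rintro u ⟨i, hi⟩
    rw [Set.infinite_iff_exists_gt]
    intro N
    induction N with
    | zero =>
      obtain ⟨d, hd, -, hocc⟩ := next u i (u.length + 1) (by omega) (by omega) hi
      exact ⟨i + d, hocc, by omega⟩
    | succ N ih =>
      obtain ⟨j, hj, hNj⟩ := ih
      obtain ⟨d, hd, -, hocc⟩ := next u j (u.length + 1) (by omega) (by omega) hj
      exact ⟨j + d, hocc, by omega⟩
  · intro u hu _
    apply sSup_le
    rintro _ ⟨i, j, hij, hi, hj, hcons, rfl⟩
    obtain ⟨d, hd, hdK, hocc⟩ := next u i u.length (List.length_pos_iff.mpr hu) le_rfl hi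
    have : j ≤ i + d := by
      by_contra hlt
      exact hcons (i + d) (by omega) (by omega) hocc
    exact_mod_cast (by omega : j - i ≤ K * u.length)

/-- A square root can be built greedily from positions satisfying an invariant `P`. -/
theorem isSquareRoot_of_invariant {v w : ℕ → α} (P : ℕ → Prop) (h0 : P 0)
    (h : ∀ p, P p → ∃ u : List α, IsMinimalSquare (u ++ u) ∧ OccursAt w (u ++ u) (2 * p) ∧
      OccursAt v u p ∧ P (p + u.length)) : IsSquareRoot v w := by
  choose! r hmin hw hv hP using h
  let pos : ℕ → ℕ := fun n => Nat.rec 0 (fun _ p => p + (r p).length) n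
  have pos_succ : ∀ n, pos (n + 1) = pos n + (r (pos n)).length := fun _ => rfl
  have hpos : ∀ n, P (pos n) := by
    intro n
    induction n with
    | zero => exact h0
    | succ n ih => exact hP _ ih
  have hne : ∀ n, r (pos n) ≠ [] := by
    intro n hn
    obtain ⟨u, hu, heq⟩ := (hmin _ (hpos n)).1
    rw [hn] at heq
    exact hu (List.append_eq_nil_iff.mp heq.symm).1
  refine ⟨fun n => r (pos n), fun n => hmin _ (hpos n), ⟨fun n => ?_, fun n => ?_⟩, hne,
    fun n => ?_⟩
  · exact fun hn => hne n (List.append_eq_nil_iff.mp hn).1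
  · suffices H : OccursAt w ((List.range n).map fun n => r (pos n) ++ r (pos n)).flatten 0 ∧
        ((List.range n).map fun n => r (pos n) ++ r (pos n)).flatten.length = 2 * pos n from H.1
    induction n with
    | zero => exact ⟨by simp [OccursAt], rfl⟩
    | succ n ih =>
      rw [List.range_succ, List.map_append, List.flatten_append]
      refine ⟨ih.1.append ?_, ?_⟩
      · rw [ih.2, Nat.zero_add]
        simpa using hw _ (hpos n)
      · rw [List.length_append, ih.2, pos_succ]
        simp only [List.map_cons, List.map_nil, List.flatten_cons, List.flatten_nil,
          List.append_nil, List.length_append]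
        omega
  · suffices H : OccursAt v ((List.range n).map fun n => r (pos n)).flatten 0 ∧
        ((List.range n).map fun n => r (pos n)).flatten.length = pos n from H.1
    induction n with
    | zero => exact ⟨by simp [OccursAt], rfl⟩
    | succ n ih =>
      rw [List.range_succ, List.map_append, List.flatten_append]
      refine ⟨ih.1.append ?_, ?_⟩
      · rw [ih.2, Nat.zero_add]
        simpa using hv _ (hpos n)
      · rw [List.length_append, ih.2, pos_succ]
        simp

end General

/-! ### Paperfolding sequences: recurrence and aperiodicity -/

section Paperfolding

/-- The paperfolding sequence with folding instructions `f`: its value at `2 ^ k * (2 * j + 1)` is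
`f k`, negated if `j` is odd. -/
def paperfold (f : ℕ → Bool) (m : ℕ) : Bool :=
  xor (f (padicValNat 2 m)) (m / 2 ^ padicValNat 2 m / 2).bodd

theorem paperfold_two_pow_mul (f : ℕ → Bool) (k j : ℕ) :
    paperfold f (2 ^ k * (2 * j + 1)) = xor (f k) j.bodd := by
  have hv : padicValNat 2 (2 ^ k * (2 * j + 1)) = k := by
    rw [padicValNat.mul (by positivity) (by omega), padicValNat.prime_pow,
      padicValNat.eq_zero_of_not_dvd (by omega), Nat.add_zero]
  rw [paperfold, hv, Nat.mul_div_cancel_left _ (by positivity)]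
  congr 2
  omega

theorem exists_eq_two_pow_mul {m : ℕ} (hm : 0 < m) : ∃ k j, m = 2 ^ k * (2 * j + 1) := by
  obtain ⟨k, o, ⟨j, rfl⟩, h⟩ := Nat.exists_eq_two_pow_mul_odd hm.ne'
  exact ⟨k, j, h⟩

theorem bodd_add_two_mul (j t : ℕ) : (j + 2 * t).bodd = j.bodd := by
  simp [Nat.bodd_add, Nat.bodd_mul]

theorem paperfold_add_of_not_dvd (f : ℕ → Bool) {k m : ℕ} (h : ¬ 2 ^ k ∣ m) (t : ℕ) :
    paperfold f (m + 2 ^ (k + 1) * t) = paperfold f m := by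
  have hm : 0 < m := Nat.pos_of_ne_zero fun h0 => h (h0 ▸ dvd_zero _)
  obtain ⟨v, j, rfl⟩ := exists_eq_two_pow_mul hm
  have hv : v < k := by
    by_contra hge
    exact h ((pow_dvd_pow 2 (by omega)).mul_right _)
  obtain ⟨e, rfl⟩ := Nat.exists_eq_add_of_lt hv
  have : 2 ^ v * (2 * j + 1) + 2 ^ (v + e + 1 + 1) * t =
      2 ^ v * (2 * (j + 2 * (2 ^ e * t)) + 1) := by ring
  rw [this, paperfold_two_pow_mul, paperfold_two_pow_mul, bodd_add_two_mul]

theorem exists_paperfold_add (f : ℕ → Bool) (k : ℕ) {q : ℕ} (hq : 0 < q) :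
    ∃ t, 0 < t ∧ t ≤ 4 ∧ paperfold f (2 ^ k * q + 2 ^ (k + 1) * t) = paperfold f (2 ^ k * q) := by
  obtain ⟨e, j, rfl⟩ := exists_eq_two_pow_mul hq
  rcases e with _ | _ | e
  · refine ⟨2, by omega, by omega, ?_⟩
    have h1 : 2 ^ k * (2 ^ 0 * (2 * j + 1)) + 2 ^ (k + 1) * 2 =
      2 ^ k * (2 * (j + 2 * 1) + 1) := by ring
    rw [h1, pow_zero, one_mul, paperfold_two_pow_mul, paperfold_two_pow_mul, bodd_add_two_mul]
  · refine ⟨4, by omega, by omega, ?_⟩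
    have h1 : 2 ^ k * (2 ^ (0 + 1) * (2 * j + 1)) + 2 ^ (k + 1) * 4 =
      2 ^ (k + 1) * (2 * (j + 2 * 1) + 1) := by ring
    have h2 : 2 ^ k * (2 ^ (0 + 1) * (2 * j + 1)) = 2 ^ (k + 1) * (2 * j + 1) := by ring
    rw [h1, h2, paperfold_two_pow_mul, paperfold_two_pow_mul, bodd_add_two_mul]
  -- Shifts by 1 and 3 both lead to valuation `k + 1`, at consecutive indices `c` and `c + 1`, where
  -- the values are opposite; one of them is right.
  · set c := 2 ^ e * (2 * j + 1) with hc
    have h1 : 2 ^ k * (2 ^ (e + 1 + 1) * (2 * j + 1)) + 2 ^ (k + 1) * 1 =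
      2 ^ (k + 1) * (2 * c + 1) := by rw [hc]; ring
    have h3 : 2 ^ k * (2 ^ (e + 1 + 1) * (2 * j + 1)) + 2 ^ (k + 1) * 3 =
      2 ^ (k + 1) * (2 * (c + 1) + 1) := by rw [hc]; ring
    generalize paperfold f (2 ^ k * (2 ^ (e + 1 + 1) * (2 * j + 1))) = b
    by_cases hb : xor (f (k + 1)) c.bodd = b
    · exact ⟨1, by omega, by omega, by rw [h1, paperfold_two_pow_mul, hb]⟩
    · refine ⟨3, by omega, by omega, ?_⟩
      rw [h3, paperfold_two_pow_mul, Nat.bodd_succ]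
      revert hb
      cases f (k + 1) <;> cases c.bodd <;> cases b <;> decide

/-- A window of length `n ≤ 2 ^ K` has at most one multiple of `2 ^ K`. Elsewhere `2 ^ (K + 1)` acts
as a period, and some multiple of it, at most fourfold, also suits the exception. Since `2 ^ K < 2 *
n`, the shift is below `16 * n`. -/
theorem exists_paperfold_shift (f : ℕ → Bool) {i n : ℕ} (hi : 0 < i) (hn : 0 < n) :
    ∃ d, 0 < d ∧ d ≤ 16 * n ∧ ∀ k < n, paperfold f (i + k + d) = paperfold f (i + k) := by
  obtain ⟨K, hnK, hKn⟩ : ∃ K, n ≤ 2 ^ K ∧ 2 ^ K < 2 * n := by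
    refine ⟨Nat.clog 2 n, Nat.le_pow_clog (by omega) n, ?_⟩
    rcases Nat.lt_or_ge 1 n with h | h
    · have h1 := Nat.pow_pred_clog_lt_self (b := 2) (by omega) h
      have h2 : 0 < Nat.clog 2 n := Nat.clog_pos (by omega) h
      obtain ⟨c, hc⟩ := Nat.exists_eq_succ_of_ne_zero h2.ne'
      rw [hc] at h1 ⊢
      rw [Nat.pred_succ] at h1
      rw [Nat.pow_succ]
      omega
    · obtain rfl : n = 1 := by omega
      simp
  have hpow : 2 ^ (K + 1) = 2 * 2 ^ K := by ring
  by_cases hex : ∃ k < n, 2 ^ K ∣ i + k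
  · obtain ⟨k₀, hk₀, q, hq⟩ := hex
    have hq0 : 0 < q := Nat.pos_of_ne_zero fun h => by rw [h] at hq; omega
    obtain ⟨t, ht0, ht4, ht⟩ := exists_paperfold_add f K hq0
    refine ⟨2 ^ (K + 1) * t, by positivity, ?_, fun k hk => ?_⟩
    · have : 2 ^ (K + 1) * t ≤ 2 ^ (K + 1) * 4 := Nat.mul_le_mul_left _ ht4
      omega
    · by_cases hkk : k = k₀
      · rw [hkk, hq, ht]
      · apply paperfold_add_of_not_dvd
        intro hdvd
        have h0 : 2 ^ K ∣ i + k₀ := ⟨q, hq⟩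
        rcases Nat.lt_or_gt_of_ne hkk with h | h
        · have := Nat.le_of_dvd (by omega) (Nat.dvd_sub h0 hdvd)
          omega
        · have := Nat.le_of_dvd (by omega) (Nat.dvd_sub hdvd h0)
          omega
  · push Not at hex
    refine ⟨2 ^ (K + 1) * 1, by positivity, by omega, fun k hk => ?_⟩
    exact paperfold_add_of_not_dvd f (hex k hk) 1

theorem paperfold_not_ultimatelyPeriodic (f : ℕ → Bool) {N p : ℕ} (hp : 0 < p)
    (h : ∀ m, N ≤ m → paperfold f (m + p) = paperfold f m) : False := by
  obtain ⟨k, o, rfl⟩ := exists_eq_two_pow_mul hp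
  -- A position beyond `N` with the same 2-adic valuation as the period; adding the period twice
  -- flips the value there.
  have hN : N ≤ 2 ^ k * (2 * N + 1) := by
    have : 1 * (2 * N + 1) ≤ 2 ^ k * (2 * N + 1) :=
      Nat.mul_le_mul_right _ (Nat.one_le_two_pow)
    omega
  have h1 := h _ (hN.trans (Nat.le_add_right _ (2 ^ k * (2 * o + 1))))
  rw [h _ hN] at h1
  have h2 : 2 ^ k * (2 * N + 1) + 2 ^ k * (2 * o + 1) + 2 ^ k * (2 * o + 1) =
      2 ^ k * (2 * (N + 1 + 2 * o) + 1) := by ring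
  rw [h2, paperfold_two_pow_mul, paperfold_two_pow_mul, bodd_add_two_mul, Nat.bodd_succ] at h1
  revert h1
  cases f k <;> cases N.bodd <;> decide

theorem exists_paperfold_eq (f : ℕ → Bool) (b : Bool) : ∃ q, paperfold f (q + 1) = b := by
  have h0 := paperfold_two_pow_mul f 0 0
  have h1 := paperfold_two_pow_mul f 0 1
  by_cases hb : f 0 = b
  · exact ⟨0, by simpa [hb] using h0⟩
  · refine ⟨2, ?_⟩
    simp only [pow_zero, one_mul, Nat.mul_one, Nat.reduceAdd] at h1
    rw [h1]
    revert hb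
    cases f 0 <;> cases b <;> decide

end Paperfolding

/-! ### Products of the two blocks -/

section Blocks

/-- The common square root of the two blocks. -/
def blockRoot : List (Fin 2) := [0, 1, 0, 1, 0, 0, 1, 0]

/-- Two distinct products of minimal squares with the same square root `blockRoot`. The second half
of `block true` is `blockRoot` with its first two letters exchanged. -/
def block : Bool → List (Fin 2)
  | false => [0, 1, 0, 1, 0, 0, 1, 0, 0, 1, 0, 1, 0, 0, 1, 0]
  | true => [0, 1, 0, 1, 0, 0, 1, 0, 1, 0, 0, 1, 0, 0, 1, 0]

/-- The roots of the minimal squares of the Fibonacci word. -/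
def roots : List (List (Fin 2)) :=
  [[0], [0, 1], [0, 1, 0], [1, 0], [1, 0, 0], [1, 0, 0, 1, 0]]

theorem length_block (b : Bool) : (block b).length = 16 := by cases b <;> rfl

/-- The infinite product of the blocks selected by `x`. -/
def blockWord (x : ℕ → Bool) (n : ℕ) : Fin 2 := (block (x (n / 16))).getD (n % 16) 0

theorem occursAt_block (x : ℕ → Bool) (q : ℕ) : OccursAt (blockWord x) (block (x q)) (16 * q) := by
  rw [occursAt_iff]
  intro k hk
  have hk' : k < 16 := by rwa [length_block] at hk
  have h1 : (16 * q + k) / 16 = q := by omega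
  have h2 : (16 * q + k) % 16 = k := by omega
  rw [blockWord, h1, h2, List.getD_eq_getElem _ _ hk]

theorem occursAt_block_append (x : ℕ → Bool) (q : ℕ) :
    OccursAt (blockWord x) (block (x q) ++ block (x (q + 1))) (16 * q) :=
  (occursAt_block x q).append (by rw [length_block]; exact occursAt_block x (q + 1))

theorem isMinimalSquare_of_mem_roots : ∀ u ∈ roots, IsMinimalSquare (u ++ u) := by
  intro u hu
  have h : ∀ u ∈ roots, u ≠ [] ∧
      ∀ k < u.length, 0 < k → u.take k ++ u.take k ≠ (u ++ u).take (2 * k) := by decide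
  exact isMinimalSquare_append_self (h u hu).1 (h u hu).2

theorem exists_square_occursAt_blockWord (x : ℕ → Bool) (i : ℕ) :
    ∃ u ∈ roots, OccursAt (blockWord x) (u ++ u) i := by
  have h : ∀ a b : Bool, ∀ r < 16, ∃ u ∈ roots, (u ++ u) <+: (block a ++ block b).drop r := by
    decide
  obtain ⟨u, hu, hpre⟩ := h (x (i / 16)) (x (i / 16 + 1)) (i % 16) (Nat.mod_lt _ (by omega))
  refine ⟨u, hu, ?_⟩
  have := (occursAt_block_append x (i / 16)).of_prefix_drop hpre
  rwa [Nat.div_add_mod] at this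

theorem minimalSquares_blockWord {x : ℕ → Bool} (hx : ∀ b, ∃ q, x q = b) :
    minimalSquares (blockWord x) = ((roots.map fun u => u ++ u).toFinset : Set (List (Fin 2))) := by
  ext s
  simp only [minimalSquares, Set.mem_ofPred_eq, List.coe_toFinset, List.mem_map]
  constructor
  · rintro ⟨hs, i, hi⟩
    obtain ⟨u, hu, hocc⟩ := exists_square_occursAt_blockWord x i
    exact ⟨u, hu, (isMinimalSquare_of_mem_roots u hu).eq_of_occursAt hs hocc hi⟩
  · rintro ⟨u, hu, rfl⟩
    refine ⟨isMinimalSquare_of_mem_roots u hu, ?_⟩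
    have h : ∀ u ∈ roots, ∃ b, ∃ r < 16, (u ++ u) <+: (block b).drop r := by decide
    obtain ⟨b, r, -, hpre⟩ := h u hu
    obtain ⟨q, rfl⟩ := hx b
    exact ⟨_, (occursAt_block x q).of_prefix_drop hpre⟩

theorem blockWord_eq_of_eq {x : ℕ → Bool} {n d : ℕ} (h : x (n / 16 + d) = x (n / 16)) :
    blockWord x (n + 16 * d) = blockWord x n := by
  rw [blockWord, blockWord, Nat.add_mul_div_left _ _ (by omega), Nat.add_mul_mod_self_left, h]

/-- Index 8 is the first at which the blocks differ, so this letter decodes `x q`. -/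
theorem blockWord_sixteen_mul_add_eight (x : ℕ → Bool) (q : ℕ) :
    blockWord x (16 * q + 8) = if x q then 1 else 0 := by
  have h1 : (16 * q + 8) / 16 = q := by omega
  have h2 : (16 * q + 8) % 16 = 8 := by omega
  rw [blockWord, h1, h2]
  cases x q <;> rfl

theorem eq_of_blockWord_eq {x y : ℕ → Bool} {p q : ℕ}
    (h : blockWord x (16 * p + 8) = blockWord y (16 * q + 8)) : x p = y q := by
  rw [blockWord_sixteen_mul_add_eight, blockWord_sixteen_mul_add_eight] at h
  revert h
  cases x p <;> cases y q <;> decide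

theorem UltimatelyPeriodic.of_blockWord {x : ℕ → Bool} (h : UltimatelyPeriodic (blockWord x)) :
    UltimatelyPeriodic x := by
  obtain ⟨N, p, hp, hw⟩ := h
  refine ⟨N, p, hp, fun n hn => eq_of_blockWord_eq ?_⟩
  have hmul : ∀ t m, N ≤ m → blockWord x (m + p * t) = blockWord x m := by
    intro t m hm
    induction t with
    | zero => rfl
    | succ t ih => rw [Nat.mul_succ, ← Nat.add_assoc, hw _ (by omega), ih]
  -- The multiple `16 * p` of the period respects the block boundaries.
  rw [← hmul 16 (16 * n + 8) (by omega)]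
  congr 1
  ring

theorem linearlyRecurrent_blockWord {x : ℕ → Bool} {K : ℕ}
    (h : ∀ i n, 0 < n → ∃ d, 0 < d ∧ d ≤ K * n ∧ ∀ k < n, x (i + k + d) = x (i + k)) :
    LinearlyRecurrent (blockWord x) := by
  refine linearlyRecurrent_of_shift (K := 16 * (K * 2)) fun i n hn => ?_
  -- A window of `n` letters meets at most `n + 1` blocks, and `n + 1 ≤ 2 * n`.
  obtain ⟨d, hd, hdK, hx⟩ := h (i / 16) (n + 1) (by omega)
  refine ⟨16 * d, by omega, ?_, fun k hk => blockWord_eq_of_eq ?_⟩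
  · have : K * (n + 1) ≤ K * (2 * n) := Nat.mul_le_mul_left _ (by omega)
    rw [Nat.mul_assoc, Nat.mul_assoc]
    omega
  · obtain ⟨e, he⟩ : ∃ e, (i + k) / 16 = i / 16 + e := ⟨(i + k) / 16 - i / 16, by omega⟩
    rw [he]
    exact hx e (by omega)

/-- The purely periodic word with period `blockRoot`. -/
def rootWord (n : ℕ) : Fin 2 := blockRoot.getD (n % 8) 0

theorem purelyPeriodic_rootWord : PurelyPeriodic rootWord :=
  ⟨8, by omega, fun n => by rw [rootWord, rootWord, Nat.add_mod_right]⟩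

theorem occursAt_blockRoot (q : ℕ) : OccursAt rootWord blockRoot (8 * q) := by
  rw [occursAt_iff]
  intro k hk
  have hk' : k < 8 := hk
  have h2 : (8 * q + k) % 8 = k := by omega
  rw [rootWord, h2, List.getD_eq_getElem _ _ hk]

theorem isSquareRoot_rootWord (x : ℕ → Bool) : IsSquareRoot rootWord (blockWord x) := by
  refine isSquareRoot_of_invariant
    -- The cuts of `blockRoot` are 01·0·10010 for one block and 01·0·10·010 for the other; only the
    -- latter stops at offset 5.
    (fun p => ∃ q, p = 8 * q ∨ p = 8 * q + 2 ∨ p = 8 * q + 3 ∨ (p = 8 * q + 5 ∧ x q = true))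
    ⟨0, by simp⟩ ?_
  have key : ∀ q r, ∀ u ∈ roots, (u ++ u) <+: (block (x q)).drop (2 * r) →
      u <+: blockRoot.drop r → IsMinimalSquare (u ++ u) ∧
        OccursAt (blockWord x) (u ++ u) (2 * (8 * q + r)) ∧ OccursAt rootWord u (8 * q + r) := by
    intro q r u hu h1 h2
    refine ⟨isMinimalSquare_of_mem_roots u hu, ?_, (occursAt_blockRoot q).of_prefix_drop h2⟩
    have := (occursAt_block x q).of_prefix_drop h1
    rwa [show 16 * q + 2 * r = 2 * (8 * q + r) by ring] at this
  rintro p ⟨q, rfl | rfl | rfl | ⟨rfl, hq⟩⟩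
  · obtain ⟨h1, h2, h3⟩ := key q 0 [0, 1] (by decide) (by cases x q <;> decide) (by decide)
    exact ⟨_, h1, h2, h3, q, Or.inr (Or.inl rfl)⟩
  · obtain ⟨h1, h2, h3⟩ := key q 2 [0] (by decide) (by cases x q <;> decide) (by decide)
    exact ⟨_, h1, h2, h3, q, Or.inr (Or.inr (Or.inl rfl))⟩
  · cases hq : x q with
    | false =>
      obtain ⟨h1, h2, h3⟩ :=
        key q 3 [1, 0, 0, 1, 0] (by decide) (by rw [hq]; decide) (by decide)
      exact ⟨_, h1, h2, h3, q + 1, Or.inl rfl⟩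
    | true =>
      obtain ⟨h1, h2, h3⟩ := key q 3 [1, 0] (by decide) (by rw [hq]; decide) (by decide)
      exact ⟨_, h1, h2, h3, q, Or.inr (Or.inr (Or.inr ⟨rfl, hq⟩))⟩
  · obtain ⟨h1, h2, h3⟩ := key q 5 [0, 1, 0] (by decide) (by rw [hq]; decide) (by decide)
    exact ⟨_, h1, h2, h3, q + 1, Or.inl rfl⟩

theorem optimalSquareful_blockWord {x : ℕ → Bool} (hx : Aperiodic x) (hx' : ∀ b, ∃ q, x q = b) :
    OptimalSquareful (blockWord x) := by
  refine ⟨fun h => hx h.of_blockWord, ⟨fun i => ?_, ?_⟩, ?_⟩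
  · obtain ⟨u, hu, hocc⟩ := exists_square_occursAt_blockWord x i
    exact ⟨_, isMinimalSquare_of_mem_roots u hu, hocc⟩
  · rw [minimalSquares_blockWord hx']
    exact Finset.finite_toSet _
  · rw [minimalSquares_blockWord hx', Set.encard_coe_eq_coe_finsetCard]
    have : (roots.map fun u => u ++ u).toFinset.card = 6 := by decide
    rw [this]
    rfl

end Blocks

/-! ### Uncountably many words -/

theorem aperiodic_paperfold_succ (f : ℕ → Bool) : Aperiodic fun n => paperfold f (n + 1) := by
  rintro ⟨N, p, hp, h⟩
  refine paperfold_not_ultimatelyPeriodic f (N := N + 1) hp fun m hm => ?_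
  obtain ⟨n, rfl⟩ : ∃ n, m = n + 1 := ⟨m - 1, by omega⟩
  have := h n (by omega)
  dsimp only at this
  rwa [Nat.add_right_comm] at this

theorem blockWord_paperfold_injective :
    Function.Injective fun f : ℕ → Bool => blockWord fun n => paperfold f (n + 1) := by
  intro f g hfg
  funext k
  have h := eq_of_blockWord_eq (congrFun hfg (16 * (2 ^ k - 1) + 8))
  -- The paperfolding value at `2 ^ k` is `f k` itself.
  have hk : 2 ^ k - 1 + 1 = 2 ^ k * (2 * 0 + 1) := by
    have := Nat.one_le_two_pow (n := k)
    omega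
  rw [hk, paperfold_two_pow_mul, paperfold_two_pow_mul] at h
  simpa using h

end InfWord

theorem mainTheorem11 :
    ¬ Set.Countable {w : ℕ → Fin 2 | InfWord.LinearlyRecurrent w ∧ InfWord.OptimalSquareful w ∧
      ∃ v : ℕ → Fin 2, InfWord.IsSquareRoot v w ∧ InfWord.PurelyPeriodic v} := by
  intro hcount
  have hpre := hcount.preimage InfWord.blockWord_paperfold_injective
  have huniv : (Set.univ : Set (ℕ → Bool)).Countable := by
    refine hpre.mono fun f _ => Set.mem_preimage.mpr ?_
    refine ⟨?_, ?_, InfWord.rootWord, InfWord.isSquareRoot_rootWord _,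
      InfWord.purelyPeriodic_rootWord⟩
    · refine InfWord.linearlyRecurrent_blockWord (K := 16) fun i n hn => ?_
      obtain ⟨d, hd, hdn, h⟩ := InfWord.exists_paperfold_shift f (Nat.succ_pos i) hn
      refine ⟨d, hd, hdn, fun k hk => ?_⟩
      have := h k hk
      rwa [show i.succ + k + d = i + k + d + 1 by omega,
        show i.succ + k = i + k + 1 by omega] at this
    · exact InfWord.optimalSquareful_blockWord (InfWord.aperiodic_paperfold_succ f)
        (InfWord.exists_paperfold_eq f)
  obtain ⟨e, he⟩ := huniv.exists_eq_range Set.univ_nonempty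
  -- Cantor's diagonal argument.
  have hdiag : (fun n => !(e n n)) ∈ Set.range e := he ▸ Set.mem_univ _
  obtain ⟨n, hn⟩ := hdiag
  have := congrFun hn n
  revert this
  cases e n n <;> decide
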